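/- Consider a production system with deterioration levels $\{0,1,\dots,\xi\}$, where $\xi\in\mathbb N$ is the failure level, production rates $s\in[0,\bar s]$ with $0<\bar s<\infty$, a base rate $\lambda\ge 0$, a deterioration function $f$ and a revenue function $r$ on $[0,\bar s]$, both continuous and (weakly) increasing with $f(0)=0$ and $r(0)\le 0$, and an increasing convex maintenance cost $c_m:\{0,\dots,\xi\}\to[0,\infty)$. While production runs at rate $s$, the deterioration level increases by one with intensity $\lambda f(s)$ and revenue accrues at rate $r(s)$. A production policy chooses the rate at each time from the deterioration history up to that time (non-anticipating), and production must be off ($s=0$) once the level is $\xi$. For $t\ge 0$ let $$J^*_\lambda(x,t)=\sup_u \mathbb E_u\Big[\int_0^t r(s_k)\,dk-c_m(X_{\mathrm{end}})\Big]$$ be the optimal expected profit when the level is $x$ and $t$ time units remain until planned maintenance; here $s_k$ is the production rate at time $k$, $X_{\mathrm{end}}$ is the level at the maintenance moment, and the supremum is over all such policies $u$. For $T>0$ let $g(T)=J^*_\lambda(0,T)/T$ be the average profit per time unit when maintenance is planned every $T$ time units. Theorem. Let $T'>0$ be a strict local maximizer of $g$ on $(0,\infty)$. Then $T'$ is the strict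 global maximizer of $g$: $g(T)<g(T')$ for every $T>0$ with $T\ne T'$. Moreover, $g$ is then unimodal: it is strictly increasing on $(0,T']$ and strictly decreasing on $[T',\infty)$. -/

import Mathlib

open MeasureTheory ProbabilityTheory Filter Topology Set

noncomputable section

/-- The data of a production system that deteriorates according to a controlled Poisson process.
The functions `f` and `r` are only used on `[0, smax]`, and `c` only on `{0, …, ξ}`. -/
structure ProductionSystem where
  /-- failure level -/
  ξ : ℕ
  /-- maximum production rate -/
  smax : ℝ
  /-- base rate of the deterioration process -/
  lam : ℝ
  /-- deterioration function -/
  f : ℝ → ℝ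
  /-- revenue function -/
  r : ℝ → ℝ
  /-- maintenance cost as a function of the deterioration level -/
  c : ℕ → ℝ

namespace ProductionSystem

/-- The standing assumptions on a production system. -/
structure IsStandard (S : ProductionSystem) : Prop where
  smax_pos : 0 < S.smax
  lam_nonneg : 0 ≤ S.lam
  f_cont : ContinuousOn S.f (Icc 0 S.smax)
  f_mono : MonotoneOn S.f (Icc 0 S.smax)
  f_zero : S.f 0 = 0
  r_cont : ContinuousOn S.r (Icc 0 S.smax)
  r_mono : MonotoneOn S.r (Icc 0 S.smax)
  r_zero : S.r 0 ≤ 0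
  c_nonneg : ∀ x, x ≤ S.ξ → 0 ≤ S.c x
  c_mono : ∀ x, x + 1 ≤ S.ξ → S.c x ≤ S.c (x + 1)
  c_convex : ∀ x, x + 2 ≤ S.ξ → S.c (x + 1) - S.c x ≤ S.c (x + 2) - S.c (x + 1)

/-- An admissible non-anticipating production policy for a system that starts in deterioration
level `x`. Time `k` is the time elapsed since the start. The value `rate n τ k` is the production
rate at time `k` if exactly `n` deterioration increments have occurred so far, at the times
`τ 0, …, τ (n - 1)`. Production is off as soon as the failure level is reached. -/
structure Policy (S : ProductionSystem) (x : ℕ) where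
  rate : (n : ℕ) → (Fin n → ℝ) → ℝ → ℝ
  measurable_rate : ∀ n, Measurable (fun p : (Fin n → ℝ) × ℝ => rate n p.1 p.2)
  rate_mem : ∀ n τ k, rate n τ k ∈ Icc 0 S.smax
  rate_failed : ∀ n τ k, S.ξ ≤ x + n → rate n τ k = 0

/-- The time of the last increment in a history of `n` increments (time `0` if there is none). -/
def lastTime : (n : ℕ) → (Fin n → ℝ) → ℝ
  | 0, _ => 0
  | n + 1, τ => τ (Fin.last n)

namespace Policy

variable {S : ProductionSystem} {x : ℕ}

/-- The time of the next increment after the history `τ` of `n` increments, when the increments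
have intensity `lam * f (production rate)`: the first time at which the intensity accumulated since
the last increment reaches the level `a` (a unit exponential random variable below).
Only increments in `[0, t]` matter; `t + 1` stands for an increment that does not occur by then. -/
def nextJump (u : Policy S x) (t : ℝ) (n : ℕ) (τ : Fin n → ℝ) (a : ℝ) : ℝ :=
  sInf (insert (t + 1) {k : ℝ | lastTime n τ ≤ k ∧
    a ≤ ∫ v in (lastTime n τ)..k, S.lam * S.f (u.rate n τ v)})

/-- The times of the first `n` increments, driven by the exponential variables `e 0, e 1, …`. -/
def jumpTimes (u : Policy S x) (t : ℝ) (e : ℕ → ℝ) : (n : ℕ) → (Fin n → ℝ)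
  | 0 => Fin.elim0
  | n + 1 => Fin.snoc (α := fun _ => ℝ) (jumpTimes u t e n)
      (nextJump u t n (jumpTimes u t e n) (e n))

/-- The number of increments up to time `k`. -/
def jumpCount (u : Policy S x) (t : ℝ) (e : ℕ → ℝ) (k : ℝ) : ℕ :=
  {n : ℕ | u.jumpTimes t e (n + 1) (Fin.last n) ≤ k}.ncard

/-- The deterioration level at elapsed time `k`, that is, at time `t - k` before maintenance. -/
def level (u : Policy S x) (t : ℝ) (e : ℕ → ℝ) (k : ℝ) : ℕ :=
  x + u.jumpCount t e k

/-- The production rate that the policy prescribes at time `k` along the realized history. -/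
def production (u : Policy S x) (t : ℝ) (e : ℕ → ℝ) (k : ℝ) : ℝ :=
  u.rate (u.jumpCount t e k) (u.jumpTimes t e (u.jumpCount t e k)) k

/-- The profit along a sample path: revenue over the `t` time units until maintenance, minus the
maintenance cost of the final deterioration level. -/
def pathProfit (u : Policy S x) (t : ℝ) (e : ℕ → ℝ) : ℝ :=
  (∫ k in (0 : ℝ)..t, S.r (u.production t e k)) - S.c (u.level t e t)

/-- The expected profit, where `e 0, e 1, …` are independent unit exponential random variables. -/
def expectedProfit (u : Policy S x) (t : ℝ) : ℝ :=
  ∫ e, u.pathProfit t e ∂(Measure.infinitePi (fun _ : ℕ => expMeasure 1))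

end Policy

/-- The optimal expected profit from level `x` with `t` time units until planned maintenance. -/
def optimalProfit (S : ProductionSystem) (x : ℕ) (t : ℝ) : ℝ :=
  ⨆ u : Policy S x, u.expectedProfit t

/-- The average profit per time unit when maintenance is planned every `T` time units. -/
def averageProfit (S : ProductionSystem) (T : ℝ) : ℝ :=
  S.optimalProfit 0 T / T

end ProductionSystem

end

/-!
The theorem rests on concavity: for a concave function `J` on `(0, ∞)`, the superlevel sets
`{T | m ≤ J T / T} = {T | 0 ≤ J T - m * T}` of its average are intervals, so that a strict local
maximum of the average is a strict global one and the average is strictly monotone on each side of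
it (`ConcaveOn.div_lt_of_isLocalMax`, `ConcaveOn.lt_div_of_mem_openSegment`).

The optimal profit `J` at level `0` is concave in time (`ProductionSystem.concaveOn_optimalProfit`)
because it is the component `V 0` of the solution of the Hamilton–Jacobi–Bellman equations
`V n' = H (V n - V (n + 1))`, where `H d = max_s (r s - lam * f s * d)` is antitone and Lipschitz.
The value starts out concave in the level, as the maintenance cost is convex. This persists: if
`d n = V n - V (n + 1)` is the cost of an increment, then
`(d (n + 1) - d n)' = [H (d (n + 1)) - H (d (n + 2))] - [H (d n) - H (d (n + 1))]`, where the first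
bracket is nonnegative by downward induction on the level and the second is at most a constant times
`|d (n + 1) - d n|` (`ProductionSystem.IsValue.increment_le`). At the failure level the
derivative of the value is `r 0`, which plays the part of `H (d n)` there and is a lower bound of
`H`, since idling causes no deterioration.
Hence `d n' = H (d n) - H (d (n + 1))` is nonnegative, `d n` increases in time, and `V n' = H (d n)`
decreases.

That `V 0` is the optimal profit is a verification argument
(`ProductionSystem.optimalProfit_eq`). Along a sample path, the profit is `V 0 t` plus the gains
between consecutive increments (`Policy.pathProfit_eq`). Given the history, the expected gain is an
integral of `r s - lam * f s * d - H d ≤ 0` along the production rates `s`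
(`Policy.integral_gain_eq`, by Dynkin's formula `integral_reward_until_ring` for a single
exponential clock), and vanishes for the feedback policy that chooses a maximizer `s`.
-/

noncomputable section

/-! ### The Hamiltonian -/

namespace ProductionSystem

/-- The net profit rate of producing at rate `s` when one further increment costs `d`. -/
def netRate (S : ProductionSystem) (s d : ℝ) : ℝ := S.r s - S.lam * S.f s * d

/-- The largest production rate that maximizes the net profit rate at increment cost `d`. Taking
the largest maximizer makes the choice monotone in `d`, hence measurable. -/
def optRate (S : ProductionSystem) (d : ℝ) : ℝ :=
  sSup {s | s ∈ Icc 0 S.smax ∧ ∀ s' ∈ Icc 0 S.smax, S.netRate s' d ≤ S.netRate s d}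

/-- The Hamiltonian of the control problem: the maximal net profit rate at increment cost `d`. -/
def hamiltonian (S : ProductionSystem) (d : ℝ) : ℝ := S.netRate (S.optRate d) d

namespace IsStandard

variable {S : ProductionSystem} (hS : S.IsStandard)
include hS

lemma zero_mem : (0 : ℝ) ∈ Icc 0 S.smax := ⟨le_rfl, hS.smax_pos.le⟩

lemma smax_mem : S.smax ∈ Icc 0 S.smax := ⟨hS.smax_pos.le, le_rfl⟩

lemma f_nonneg {s : ℝ} (hs : s ∈ Icc 0 S.smax) : 0 ≤ S.f s :=
  hS.f_zero ▸ hS.f_mono hS.zero_mem hs hs.1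

lemma continuousOn_netRate (d : ℝ) : ContinuousOn (S.netRate · d) (Icc 0 S.smax) :=
  hS.r_cont.sub ((continuousOn_const.mul hS.f_cont).mul continuousOn_const)

lemma isGreatest_optRate (d : ℝ) :
    IsGreatest {s | s ∈ Icc 0 S.smax ∧ ∀ s' ∈ Icc 0 S.smax, S.netRate s' d ≤ S.netRate s d}
      (S.optRate d) := by
  obtain ⟨s₀, hs₀, hmax⟩ :=
    isCompact_Icc.exists_isMaxOn ⟨0, hS.zero_mem⟩ (hS.continuousOn_netRate d)
  have heq : {s | s ∈ Icc 0 S.smax ∧ ∀ s' ∈ Icc 0 S.smax, S.netRate s' d ≤ S.netRate s d} =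
      Icc 0 S.smax ∩ (S.netRate · d) ⁻¹' Ici (S.netRate s₀ d) := by
    ext s
    exact ⟨fun h => ⟨h.1, h.2 s₀ hs₀⟩, fun h => ⟨h.1, fun s' hs' => (hmax hs').trans h.2⟩⟩
  refine IsCompact.isGreatest_sSup ?_ ⟨s₀, hs₀, fun s' hs' => hmax hs'⟩
  rw [heq]
  exact isCompact_Icc.of_isClosed_subset
    ((hS.continuousOn_netRate d).preimage_isClosed_of_isClosed isClosed_Icc isClosed_Ici)
    inter_subset_left

lemma optRate_mem (d : ℝ) : S.optRate d ∈ Icc 0 S.smax := (hS.isGreatest_optRate d).1.1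

lemma netRate_le_hamiltonian {s : ℝ} (hs : s ∈ Icc 0 S.smax) (d : ℝ) :
    S.netRate s d ≤ S.hamiltonian d := (hS.isGreatest_optRate d).1.2 s hs

lemma lam_mul_f_nonneg {s : ℝ} (hs : s ∈ Icc 0 S.smax) : 0 ≤ S.lam * S.f s :=
  mul_nonneg hS.lam_nonneg (hS.f_nonneg hs)

lemma lam_mul_f_mono {s s' : ℝ} (hs : s ∈ Icc 0 S.smax) (hs' : s' ∈ Icc 0 S.smax) (h : s ≤ s') :
    S.lam * S.f s ≤ S.lam * S.f s' :=
  mul_le_mul_of_nonneg_left (hS.f_mono hs hs' h) hS.lam_nonneg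

lemma lam_mul_f_le {s : ℝ} (hs : s ∈ Icc 0 S.smax) : S.lam * S.f s ≤ S.lam * S.f S.smax :=
  hS.lam_mul_f_mono hs hS.smax_mem hs.2

/-- The net profit rate has decreasing differences in `(s, d)`. -/
lemma antitone_optRate : Antitone S.optRate := by
  intro d₁ d₂ hd
  by_contra! hlt
  refine hlt.not_ge ((hS.isGreatest_optRate d₁).2 ⟨hS.optRate_mem d₂, fun s' hs' => ?_⟩)
  refine (hS.netRate_le_hamiltonian hs' d₁).trans ?_
  have h := hS.netRate_le_hamiltonian (hS.optRate_mem d₁) d₂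
  have hm := hS.lam_mul_f_mono (hS.optRate_mem d₁) (hS.optRate_mem d₂) hlt.le
  unfold hamiltonian netRate at *
  nlinarith

lemma antitone_hamiltonian : Antitone S.hamiltonian := by
  intro d₁ d₂ hd
  refine le_trans ?_ (hS.netRate_le_hamiltonian (hS.optRate_mem d₂) d₁)
  have := hS.lam_mul_f_nonneg (hS.optRate_mem d₂)
  unfold hamiltonian netRate
  nlinarith

/-- Idling is always possible and, since `f 0 = 0`, does not cause deterioration. -/
lemma r_zero_le_hamiltonian (d : ℝ) : S.r 0 ≤ S.hamiltonian d := by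
  have h := hS.netRate_le_hamiltonian hS.zero_mem d
  simpa [netRate, hS.f_zero] using h

lemma hamiltonian_sub_le {d₁ d₂ : ℝ} (hd : d₁ ≤ d₂) :
    S.hamiltonian d₁ - S.hamiltonian d₂ ≤ S.lam * S.f S.smax * (d₂ - d₁) := by
  have h := hS.netRate_le_hamiltonian (hS.optRate_mem d₁) d₂
  have hm := hS.lam_mul_f_le (hS.optRate_mem d₁)
  unfold hamiltonian netRate at *
  nlinarith

/-- The bound `S.lam * S.f S.smax` on the intensities is a Lipschitz constant of the
Hamiltonian. -/
lemma abs_hamiltonian_sub_le (d₁ d₂ : ℝ) :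
    |S.hamiltonian d₁ - S.hamiltonian d₂| ≤ S.lam * S.f S.smax * |d₁ - d₂| := by
  rcases le_total d₁ d₂ with h | h
  · rw [abs_of_nonneg (sub_nonneg.2 (hS.antitone_hamiltonian h)), abs_sub_comm d₁,
      abs_of_nonneg (sub_nonneg.2 h)]
    exact hS.hamiltonian_sub_le h
  · rw [abs_sub_comm, abs_of_nonneg (sub_nonneg.2 (hS.antitone_hamiltonian h)),
      abs_of_nonneg (sub_nonneg.2 h)]
    exact hS.hamiltonian_sub_le h

/-- Truncating the increment cost at zero keeps the Hamiltonian bounded. -/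
lemma hamiltonian_max_le (d : ℝ) : S.hamiltonian (max d 0) ≤ S.r S.smax := by
  have := mul_nonneg (hS.lam_mul_f_nonneg (hS.optRate_mem (max d 0))) (le_max_right d 0)
  have := hS.r_mono (hS.optRate_mem (max d 0)) hS.smax_mem (hS.optRate_mem (max d 0)).2
  unfold hamiltonian netRate
  linarith

lemma abs_hamiltonian_max_le (d : ℝ) :
    |S.hamiltonian (max d 0)| ≤ max |S.r 0| |S.r S.smax| :=
  abs_le_max_abs_abs (hS.r_zero_le_hamiltonian _) (hS.hamiltonian_max_le d)

lemma abs_hamiltonian_max_sub_le (d₁ d₂ : ℝ) :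
    |S.hamiltonian (max d₁ 0) - S.hamiltonian (max d₂ 0)| ≤ S.lam * S.f S.smax * |d₁ - d₂| :=
  (hS.abs_hamiltonian_sub_le _ _).trans <|
    mul_le_mul_of_nonneg_left (abs_max_sub_max_le_abs d₁ d₂ 0) (hS.lam_mul_f_nonneg hS.smax_mem)

lemma continuous_hamiltonian : Continuous S.hamiltonian := by
  refine LipschitzWith.continuous (K := ⟨_, hS.lam_mul_f_nonneg hS.smax_mem⟩) ?_
  exact LipschitzWith.of_dist_le_mul fun d₁ d₂ => hS.abs_hamiltonian_sub_le d₁ d₂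

end IsStandard

/-! ### The Hamilton–Jacobi–Bellman equation -/

/-- The value at one level, given the value `ψ` at the next level: a `C¹` function on the line that
solves the (truncated) Hamilton–Jacobi–Bellman equation on `[0, T]`. -/
lemma IsStandard.exists_value_step {S : ProductionSystem} (hS : S.IsStandard) {T : ℝ} (hT : 0 ≤ T)
    {ψ : ℝ → ℝ} (hψ : Continuous ψ) (v₀ : ℝ) :
    ∃ φ h : ℝ → ℝ, Continuous h ∧ (∀ w, HasDerivAt φ (h w) w) ∧ φ 0 = v₀ ∧
      ∀ w ∈ Icc 0 T, h w = S.hamiltonian (max (φ w - ψ w) 0) := by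
  -- The truncated Hamiltonian is bounded by `M`, so the solution stays within `M * T` of `v₀` and
  -- exists on all of `[0, T]`.
  set M : NNReal := ⟨max |S.r 0| |S.r S.smax|, le_max_of_le_left (abs_nonneg _)⟩
  have hPL : IsPicardLindelof (fun w v => S.hamiltonian (max (v - ψ w) 0))
      (⟨0, le_rfl, hT⟩ : Icc (0 : ℝ) T) v₀ (M * ⟨T, hT⟩) 0 M
      ⟨_, hS.lam_mul_f_nonneg hS.smax_mem⟩ := by
    refine ⟨fun w _ => LipschitzWith.lipschitzOnWith (LipschitzWith.of_dist_le_mul fun a b => ?_),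
      fun v _ => ?_, fun w _ v _ => hS.abs_hamiltonian_max_le _, ?_⟩
    · have := hS.abs_hamiltonian_max_sub_le (a - ψ w) (b - ψ w)
      rwa [sub_sub_sub_cancel_right] at this
    · exact (hS.continuous_hamiltonian.comp
        ((continuous_const.sub hψ).max continuous_const)).continuousOn
    · have : ((M * ⟨T, hT⟩ : NNReal) : ℝ) = M * T := NNReal.coe_mul M ⟨T, hT⟩
      simp [hT, this]
  obtain ⟨α, hα0, hα⟩ := hPL.exists_eq_forall_mem_Icc_hasDerivWithinAt₀
  have hαc : ContinuousOn α (Icc 0 T) := fun w hw => (hα w hw).continuousWithinAt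
  set h : ℝ → ℝ := fun w =>
    S.hamiltonian (max (IccExtend hT ((Icc 0 T).domRestrict α) w - ψ w) 0) with hh
  have hhc : Continuous h := hS.continuous_hamiltonian.comp
    (((continuousOn_iff_continuous_domRestrict.1 hαc).Icc_extend'.sub hψ).max continuous_const)
  have hheq : ∀ w ∈ Icc 0 T, h w = S.hamiltonian (max (α w - ψ w) 0) := fun w hw => by
    simp only [hh, IccExtend_of_mem hT _ hw, domRestrict_apply]
  refine ⟨fun w => v₀ + ∫ v in (0 : ℝ)..w, h v, h, hhc, fun w => ?_, by simp, fun w hw => ?_⟩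
  · exact (hhc.integral_hasStrictDerivAt 0 w).hasDerivAt.const_add v₀
  · rw [hheq w hw]
    congr 3
    have hsub : Icc 0 w ⊆ Icc 0 T := Icc_subset_Icc_right hw.2
    have hftc : ∫ v in (0 : ℝ)..w, h v = α w - α 0 := by
      refine intervalIntegral.integral_eq_sub_of_hasDerivAt_of_le hw.1 (hαc.mono hsub)
        (fun v hv => ?_) (hhc.intervalIntegrable _ _)
      rw [hheq v ⟨hv.1.le, hv.2.le.trans hw.2⟩]
      exact (hα v ⟨hv.1.le, hv.2.le.trans hw.2⟩).hasDerivAt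
        (Icc_mem_nhds hv.1 (hv.2.trans_le hw.2))
    simp only [hftc]
    rw [show α 0 = v₀ from hα0]
    ring

/-- A solution on `[0, T]` of the system of Hamilton–Jacobi–Bellman equations: `V n w` is the value
at level `n` with `w` time units until maintenance and `h n` its derivative in `w`. -/
structure IsValue (S : ProductionSystem) (T : ℝ) (V h : ℕ → ℝ → ℝ) : Prop where
  continuous_deriv : ∀ n, Continuous (h n)
  hasDerivAt : ∀ n w, HasDerivAt (V n) (h n w) w
  zero : ∀ n ≤ S.ξ, V n 0 = -S.c n
  failed : ∀ w, V S.ξ w = S.r 0 * w - S.c S.ξ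
  deriv_eq : ∀ n < S.ξ, ∀ w ∈ Icc 0 T, h n w = S.hamiltonian (max (V n w - V (n + 1) w) 0)

/-- The equations are triangular, so they can be solved level by level, down from the failure
level. -/
lemma IsStandard.exists_isValue {S : ProductionSystem} (hS : S.IsStandard) {T : ℝ} (hT : 0 ≤ T) :
    ∃ V h, S.IsValue T V h := by
  -- `U k` is the value at `k` levels before failure, paired with its derivative.
  have hstep : ∀ (k : ℕ) (p : {p : (ℝ → ℝ) × (ℝ → ℝ) //
      Continuous p.2 ∧ ∀ w, HasDerivAt p.1 (p.2 w) w}),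
      ∃ p' : {p : (ℝ → ℝ) × (ℝ → ℝ) // Continuous p.2 ∧ ∀ w, HasDerivAt p.1 (p.2 w) w},
        p'.1.1 0 = -S.c (S.ξ - (k + 1)) ∧
        ∀ w ∈ Icc 0 T, p'.1.2 w = S.hamiltonian (max (p'.1.1 w - p.1.1 w) 0) := by
    rintro k ⟨⟨ψ, ψ'⟩, -, hψ⟩
    obtain ⟨φ, h, hc, hd, h0, heq⟩ := hS.exists_value_step hT
      (continuous_iff_continuousAt.2 fun w => (hψ w).continuousAt) (-S.c (S.ξ - (k + 1)))
    exact ⟨⟨⟨φ, h⟩, hc, hd⟩, h0, heq⟩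
  choose step hstep0 hstep using hstep
  let base : {p : (ℝ → ℝ) × (ℝ → ℝ) // Continuous p.2 ∧ ∀ w, HasDerivAt p.1 (p.2 w) w} :=
    ⟨(fun w => S.r 0 * w - S.c S.ξ, fun _ => S.r 0), continuous_const, fun w => by
      simpa using ((hasDerivAt_id w).const_mul (S.r 0)).sub_const (S.c S.ξ)⟩
  let U : ℕ → {p : (ℝ → ℝ) × (ℝ → ℝ) // Continuous p.2 ∧ ∀ w, HasDerivAt p.1 (p.2 w) w} :=
    fun k => Nat.rec base step k
  have hU : ∀ k, U (k + 1) = step k (U k) := fun _ => rfl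
  refine ⟨fun n => (U (S.ξ - n)).1.1, fun n => (U (S.ξ - n)).1.2, fun n => (U _).2.1,
    fun n => (U _).2.2, fun n hn => ?_, fun w => ?_, fun n hn w hw => ?_⟩
  · rcases hk : S.ξ - n with _ | k
    · obtain rfl : n = S.ξ := by omega
      simp [U, base]
    · rw [hU, hstep0]
      congr 2
      omega
  · simp [U, base]
  · obtain ⟨k, hk⟩ : ∃ k, S.ξ - n = k + 1 := ⟨S.ξ - (n + 1), by omega⟩
    have hk' : S.ξ - (n + 1) = k := by omega
    simp only [hk, hk', hU]
    exact hstep k (U k) w hw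

/-- Comparison with the zero solution of the linear equation `D' = -L |D|`. -/
lemma nonneg_of_deriv_ge_neg_mul_abs {D D' : ℝ → ℝ} {T L : ℝ}
    (hD : ∀ w, HasDerivAt D (D' w) w) (h0 : 0 ≤ D 0)
    (hge : ∀ w ∈ Icc 0 T, -(L * |D w|) ≤ D' w) {w : ℝ} (hw : w ∈ Icc 0 T) : 0 ≤ D w := by
  -- `-D` cannot cross a barrier that grows at the rate `L + 1 > L`.
  have key : ∀ ε > 0, -D w ≤ ε * Real.exp ((L + 1) * w) := by
    intro ε hε
    have hB : ∀ v, HasDerivAt (fun v => ε * Real.exp ((L + 1) * v))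
        (ε * (Real.exp ((L + 1) * v) * (L + 1))) v := fun v => by
      simpa using (((hasDerivAt_id v).const_mul (L + 1)).exp).const_mul ε
    refine image_le_of_deriv_right_lt_deriv_boundary (f := fun v => -D v) (f' := fun v => -D' v)
      (a := 0) (b := T) (fun v _ => (hD v).neg.continuousAt.continuousWithinAt)
      (fun v _ => (hD v).neg.hasDerivWithinAt) ?_ hB (fun v hv heq => ?_) hw
    · simp only [mul_zero, Real.exp_zero]; linarith
    · have hpos : 0 < ε * Real.exp ((L + 1) * v) := by positivity
      have hge' := hge v ⟨hv.1, hv.2.le⟩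
      rw [show |D v| = ε * Real.exp ((L + 1) * v) by
        rw [← heq, abs_of_neg (by linarith)]] at hge'
      nlinarith
  by_contra! hneg
  have h1 := key (-D w / 2 / Real.exp ((L + 1) * w)) (by
    have := Real.exp_pos ((L + 1) * w); apply div_pos _ this; linarith)
  rw [div_mul_cancel₀ _ (Real.exp_pos _).ne'] at h1
  linarith

namespace IsValue

variable {S : ProductionSystem} {T : ℝ} {V h : ℕ → ℝ → ℝ}

lemma continuous (hV : S.IsValue T V h) (n : ℕ) : Continuous (V n) :=
  continuous_iff_continuousAt.2 fun w => (hV.hasDerivAt n w).continuousAt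

lemma deriv_failed (hV : S.IsValue T V h) (w : ℝ) : h S.ξ w = S.r 0 := by
  refine (hV.hasDerivAt S.ξ w).unique ?_
  rw [show V S.ξ = fun w => S.r 0 * w - S.c S.ξ from funext hV.failed]
  simpa using ((hasDerivAt_id w).const_mul (S.r 0)).sub_const (S.c S.ξ)

/-- At each time the value is concave in the level: the cost `V n - V (n + 1)` of an increment
grows with the level. The cost differences at the level `n` satisfy a differential inequality
whose forcing term has the right sign because of the same property at the level `n + 1`. -/
lemma increment_le (hV : S.IsValue T V h) (hS : S.IsStandard) (n : ℕ) (hn : n + 2 ≤ S.ξ)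
    {w : ℝ} (hw : w ∈ Icc 0 T) : V n w - V (n + 1) w ≤ V (n + 1) w - V (n + 2) w := by
  obtain ⟨k, hk⟩ := Nat.exists_eq_add_of_le hn
  induction k generalizing n w with
  | zero =>
    have hD : ∀ w, HasDerivAt (fun w => (V (n + 1) w - V (n + 2) w) - (V n w - V (n + 1) w))
        ((h (n + 1) w - h (n + 2) w) - (h n w - h (n + 1) w)) w := fun w =>
      ((hV.hasDerivAt _ w).sub (hV.hasDerivAt _ w)).sub
        ((hV.hasDerivAt _ w).sub (hV.hasDerivAt _ w))
    refine sub_nonneg.1 (nonneg_of_deriv_ge_neg_mul_abs (L := S.lam * S.f S.smax) hD ?_ ?_ hw)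
    · rw [hV.zero _ (by omega), hV.zero _ (by omega), hV.zero _ (by omega)]
      linarith [hS.c_convex n hn]
    · intro w hw
      have h1 := hV.deriv_eq n (by omega) w hw
      have h2 := hV.deriv_eq (n + 1) (by omega) w hw
      have h3 : h (n + 2) w = S.r 0 := by
        rw [show n + 2 = S.ξ by omega]; exact hV.deriv_failed w
      have h4 := hS.r_zero_le_hamiltonian (max (V (n + 1) w - V (n + 1 + 1) w) 0)
      have h5 := hS.abs_hamiltonian_max_sub_le (V (n + 1) w - V (n + 2) w) (V n w - V (n + 1) w)
      rw [h1, h2, h3]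
      have := (abs_le.1 h5).1
      linarith
  | succ k ih =>
    have hD : ∀ w, HasDerivAt (fun w => (V (n + 1) w - V (n + 2) w) - (V n w - V (n + 1) w))
        ((h (n + 1) w - h (n + 2) w) - (h n w - h (n + 1) w)) w := fun w =>
      ((hV.hasDerivAt _ w).sub (hV.hasDerivAt _ w)).sub
        ((hV.hasDerivAt _ w).sub (hV.hasDerivAt _ w))
    refine sub_nonneg.1 (nonneg_of_deriv_ge_neg_mul_abs (L := S.lam * S.f S.smax) hD ?_ ?_ hw)
    · rw [hV.zero _ (by omega), hV.zero _ (by omega), hV.zero _ (by omega)]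
      linarith [hS.c_convex n hn]
    · intro w hw
      have h1 := hV.deriv_eq n (by omega) w hw
      have h2 := hV.deriv_eq (n + 1) (by omega) w hw
      have h3 := hV.deriv_eq (n + 2) (by omega) w hw
      have h4 := hS.antitone_hamiltonian
        (max_le_max_right 0 (ih (n + 1) (by omega) hw (by omega)))
      have h5 := hS.abs_hamiltonian_max_sub_le (V (n + 1) w - V (n + 2) w) (V n w - V (n + 1) w)
      rw [h1, h2, h3]
      have := (abs_le.1 h5).1
      linarith

/-- The higher the level, the smaller the marginal value of time. -/
lemma deriv_succ_le (hV : S.IsValue T V h) (hS : S.IsStandard) {n : ℕ} (hn : n < S.ξ)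
    {w : ℝ} (hw : w ∈ Icc 0 T) : h (n + 1) w ≤ h n w := by
  rw [hV.deriv_eq n hn w hw]
  rcases (show n + 1 = S.ξ ∨ n + 2 ≤ S.ξ by omega) with hn' | hn'
  · rw [hn', hV.deriv_failed]
    exact hS.r_zero_le_hamiltonian _
  · rw [hV.deriv_eq (n + 1) (by omega) w hw]
    exact hS.antitone_hamiltonian (max_le_max_right 0 (hV.increment_le hS n hn' hw))

lemma monotoneOn_increment (hV : S.IsValue T V h) (hS : S.IsStandard) {n : ℕ} (hn : n < S.ξ) :
    MonotoneOn (fun w => V n w - V (n + 1) w) (Icc 0 T) := by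
  have hd := fun w => (hV.hasDerivAt n w).sub (hV.hasDerivAt (n + 1) w)
  refine monotoneOn_of_deriv_nonneg (convex_Icc 0 T)
    ((hV.continuous n).sub (hV.continuous (n + 1))).continuousOn
    (fun w _ => (hd w).differentiableAt.differentiableWithinAt) fun w hw => ?_
  rw [interior_Icc] at hw
  rw [show (fun w => V n w - V (n + 1) w) = V n - V (n + 1) from rfl, (hd w).deriv]
  exact sub_nonneg.2 (hV.deriv_succ_le hS hn ⟨hw.1.le, hw.2.le⟩)

lemma increment_nonneg (hV : S.IsValue T V h) (hS : S.IsStandard) {n : ℕ} (hn : n < S.ξ)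
    {w : ℝ} (hw : w ∈ Icc 0 T) : 0 ≤ V n w - V (n + 1) w := by
  have hT : (0 : ℝ) ∈ Icc 0 T := ⟨le_rfl, hw.1.trans hw.2⟩
  refine le_trans ?_ (hV.monotoneOn_increment hS hn hT hw hw.1)
  simp only
  rw [hV.zero n (by omega), hV.zero (n + 1) (by omega)]
  linarith [hS.c_mono n (by omega)]

/-- The truncation of the increment cost is inactive. -/
lemma deriv_eq_hamiltonian (hV : S.IsValue T V h) (hS : S.IsStandard) {n : ℕ} (hn : n < S.ξ)
    {w : ℝ} (hw : w ∈ Icc 0 T) : h n w = S.hamiltonian (V n w - V (n + 1) w) := by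
  rw [hV.deriv_eq n hn w hw, max_eq_left (hV.increment_nonneg hS hn hw)]

/-- The value is concave in time: as more time remains, an increment becomes more costly, so that
the Hamiltonian at the cost of an increment decreases. -/
lemma concaveOn (hV : S.IsValue T V h) (hS : S.IsStandard) {n : ℕ} (hn : n ≤ S.ξ) :
    ConcaveOn ℝ (Icc 0 T) (V n) := by
  have hderiv : deriv (V n) = h n := funext fun w => (hV.hasDerivAt n w).deriv
  refine AntitoneOn.concaveOn_of_deriv (convex_Icc 0 T) (hV.continuous n).continuousOn
    (fun w _ => (hV.hasDerivAt n w).differentiableAt.differentiableWithinAt) ?_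
  rw [interior_Icc, hderiv]
  intro w hw w' hw' hle
  rcases hn.lt_or_eq with hlt | rfl
  · rw [hV.deriv_eq_hamiltonian hS hlt (Ioo_subset_Icc_self hw),
      hV.deriv_eq_hamiltonian hS hlt (Ioo_subset_Icc_self hw')]
    exact hS.antitone_hamiltonian (hV.monotoneOn_increment hS hlt (Ioo_subset_Icc_self hw)
      (Ioo_subset_Icc_self hw') hle)
  · rw [hV.deriv_failed, hV.deriv_failed]

end IsValue

end ProductionSystem

/-! ### A single increment driven by an exponential clock -/

instance isProbabilityMeasure_expMeasure_one : IsProbabilityMeasure (expMeasure 1) :=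
  isProbabilityMeasure_expMeasure one_pos

lemma expMeasure_one_real_Ioi {x : ℝ} (hx : 0 ≤ x) :
    (expMeasure 1).real (Ioi x) = Real.exp (-x) := by
  have h := cdf_expMeasure_eq one_pos x
  rw [cdf_eq_real, if_pos hx, one_mul] at h
  rw [← compl_Iic, probReal_compl_eq_one_sub measurableSet_Iic, h]
  ring

lemma expMeasure_one_ae_pos : ∀ᵐ y ∂(expMeasure 1), 0 < y := by
  have h := expMeasure_one_real_Ioi le_rfl
  rw [neg_zero, Real.exp_zero] at h
  exact (mem_ae_iff_prob_eq_one measurableSet_Ioi).2 ((ENNReal.toReal_eq_one_iff _).1 h)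

/-- `R` is the time at which a clock with accumulated intensity `Λ` rings, so that
`ℙ (v < R) = exp (-Λ v)`; a reward that accrues until the clock rings is earned at time `v` with
this probability. -/
lemma integral_integral_min_eq {a t : ℝ} (hat : a ≤ t) {Λ R : ℝ → ℝ} (hΛ0 : ∀ v ∈ Icc a t, 0 ≤ Λ v)
    (hRm : Measurable R) (haR : ∀ y, a ≤ R y) (hR : ∀ y, ∀ z ∈ Icc a t, R y ≤ z ↔ y ≤ Λ z)
    {ρ : ℝ → ℝ} (hρ : Measurable ρ) {C : ℝ} (hC : ∀ v ∈ Icc a t, |ρ v| ≤ C) :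
    ∫ y, (∫ v in a..min (R y) t, ρ v) ∂(expMeasure 1) = ∫ v in a..t, ρ v * Real.exp (-Λ v) := by
  have hin : ∀ y, ∫ v in a..min (R y) t, ρ v =
      ∫ v in Ioo a t, {v | v < R y}.indicator ρ v := fun y => by
    rw [intervalIntegral.integral_of_le (le_min (haR y) hat), integral_Ioc_eq_integral_Ioo,
      setIntegral_indicator (show MeasurableSet {v | v < R y} from measurableSet_Iio)]
    congr 2
    ext v
    simp only [mem_Ioo, lt_min_iff, mem_inter_iff, mem_ofPred_eq]
    tauto
  simp_rw [hin]
  rw [integral_integral_swap, intervalIntegral.integral_of_le hat, integral_Ioc_eq_integral_Ioo]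
  · refine setIntegral_congr_fun measurableSet_Ioo fun v hv => ?_
    have hv' : v ∈ Icc a t := Ioo_subset_Icc_self hv
    have h1 : (fun y => {v | v < R y}.indicator ρ v) =
        (Ioi (Λ v)).indicator fun _ => ρ v := by
      ext y
      have := (hR y v hv').not
      rw [not_le, not_le] at this
      by_cases hy : v < R y
      · rw [indicator_of_mem (by exact hy), indicator_of_mem (by exact this.1 hy)]
      · rw [indicator_of_notMem (by exact hy), indicator_of_notMem (by exact fun h => hy (this.2 h))]
    simp only [h1]
    rw [integral_indicator_const _ measurableSet_Ioi, expMeasure_one_real_Ioi (hΛ0 v hv'),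
      smul_eq_mul, mul_comm]
  · refine Integrable.of_bound (C := C) ?_ ?_
    · have : Measurable fun p : ℝ × ℝ => {v | v < R p.1}.indicator ρ p.2 := by
        simp only [indicator, mem_ofPred_eq]
        exact Measurable.ite (measurableSet_lt measurable_snd (hRm.comp measurable_fst))
          (hρ.comp measurable_snd) measurable_const
      exact this.aestronglyMeasurable
    · have : ∀ᵐ p : ℝ × ℝ ∂((expMeasure 1).prod (volume.restrict (Ioo a t))), p.2 ∈ Ioo a t :=
        Measure.quasiMeasurePreserving_snd.ae (ae_restrict_mem measurableSet_Ioo)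
      filter_upwards [this] with p hp
      have hp' := hC p.2 (Ioo_subset_Icc_self hp)
      simp only [Function.uncurry]
      exact (norm_indicator_le_norm_self _ _).trans hp'

lemma intervalIntegrable_of_abs_le {g : ℝ → ℝ} (hg : Measurable g) {C : ℝ} (hC : ∀ v, |g v| ≤ C)
    (x y : ℝ) : IntervalIntegrable g volume x y :=
  (intervalIntegrable_const (c := C)).mono_fun hg.aestronglyMeasurable
    (Eventually.of_forall fun v => (hC v).trans (le_abs_self C))

lemma abs_exp_neg_sub_exp_neg_le {x y : ℝ} (hx : 0 ≤ x) (hy : 0 ≤ y) :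
    |Real.exp (-x) - Real.exp (-y)| ≤ |x - y| := by
  wlog h : x ≤ y generalizing x y
  · rw [abs_sub_comm, abs_sub_comm x]
    exact this hy hx (le_of_not_ge h)
  have h1 : Real.exp (-y) = Real.exp (-x) * Real.exp (x - y) := by rw [← Real.exp_add]; ring_nf
  have h2 := Real.add_one_le_exp (x - y)
  have h3 : Real.exp (-x) ≤ 1 := Real.exp_le_one_iff.2 (by linarith)
  have h4 := Real.exp_pos (-x)
  have h5 : Real.exp (x - y) ≤ 1 := Real.exp_le_one_iff.2 (by linarith)
  rw [abs_sub_comm x, abs_of_nonneg (by linarith : 0 ≤ y - x), h1,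
    abs_of_nonneg (by nlinarith)]
  nlinarith

/-- The derivative of `exp (-Λ) * D`, where `Λ` is the primitive of a merely measurable intensity
`q`, integrates to the increment since the product is absolutely continuous. -/
lemma integral_exp_neg_mul_deriv {a t L : ℝ} (hat : a ≤ t) {q D D' : ℝ → ℝ} (hq : Measurable q)
    (hq0 : ∀ v, 0 ≤ q v) (hqL : ∀ v, q v ≤ L) (hD' : Continuous D')
    (hD : ∀ v, HasDerivAt D (D' v) v) :
    ∫ v in a..t, Real.exp (-∫ x in a..v, q x) * (D' v - q v * D v) =
      Real.exp (-∫ x in a..t, q x) * D t - D a := by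
  have hL : 0 ≤ L := (hq0 0).trans (hqL 0)
  have hqi := intervalIntegrable_of_abs_le hq fun v => (abs_of_nonneg (hq0 v)).trans_le (hqL v)
  have hE : AbsolutelyContinuousOnInterval (fun v => Real.exp (-∫ x in a..v, q x)) a t := by
    refine LipschitzOnWith.absolutelyContinuousOnInterval (K := ⟨L, hL⟩) ?_
    rw [uIcc_of_le hat]
    refine LipschitzOnWith.of_dist_le_mul fun v hv w hw => ?_
    refine (abs_exp_neg_sub_exp_neg_le
      (intervalIntegral.integral_nonneg hv.1 fun x _ => hq0 x)
      (intervalIntegral.integral_nonneg hw.1 fun x _ => hq0 x)).trans ?_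
    rw [intervalIntegral.integral_interval_sub_left (hqi _ _) (hqi _ _)]
    exact intervalIntegral.norm_integral_le_of_norm_le_const (C := L) (f := q) fun x _ =>
      (abs_of_nonneg (hq0 x)).trans_le (hqL x)
  have hDac : AbsolutelyContinuousOnInterval D a t := by
    refine ContDiffOn.absolutelyContinuousOnInterval (ContDiff.contDiffOn ?_)
    rw [contDiff_one_iff_deriv]
    exact ⟨fun v => (hD v).differentiableAt, by rwa [funext fun v => (hD v).deriv]⟩
  have h := hE.integral_deriv_mul_eq_sub hDac
  simp only [intervalIntegral.integral_same, neg_zero, Real.exp_zero, one_mul] at h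
  rw [← h]
  refine intervalIntegral.integral_congr_ae ?_
  filter_upwards [(hqi a t).ae_hasDerivAt_integral] with v hv hvm
  have h1 : HasDerivAt (fun v => Real.exp (-∫ x in a..v, q x))
      (Real.exp (-∫ x in a..v, q x) * -q v) v :=
    (hv (uIoc_subset_uIcc hvm) a left_mem_uIcc).neg.exp
  rw [h1.deriv, (hD v).deriv]
  ring

/-- Dynkin's formula for a single increment. Revenue accrues at rate `ρ` until the clock with
intensity `q` rings or the horizon `t` is reached; the terminal reward is `ψ` at the ringing time,
or `φ t`. -/
lemma integral_reward_until_ring {a t L C : ℝ} (hat : a ≤ t) {q ρ R φ φ' ψ ψ' : ℝ → ℝ}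
    (hq : Measurable q) (hq0 : ∀ v, 0 ≤ q v) (hqL : ∀ v, q v ≤ L)
    (hρ : Measurable ρ) (hC : ∀ v, |ρ v| ≤ C)
    (hRm : Measurable R) (haR : ∀ y, a ≤ R y)
    (hR : ∀ y, ∀ z ∈ Icc a t, R y ≤ z ↔ y ≤ ∫ x in a..z, q x)
    (hφ' : Continuous φ') (hφ : ∀ v, HasDerivAt φ (φ' v) v)
    (hψ' : Continuous ψ') (hψ : ∀ v, HasDerivAt ψ (ψ' v) v) :
    ∫ y, ((∫ v in a..min (R y) t, ρ v) + if R y ≤ t then ψ (R y) else φ t) ∂(expMeasure 1) =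
      φ a + ∫ v in a..t, (ρ v + φ' v + q v * (ψ v - φ v)) * Real.exp (-∫ x in a..v, q x) := by
  have hL : 0 ≤ L := (hq0 0).trans (hqL 0)
  have hqi := intervalIntegrable_of_abs_le hq fun v => (abs_of_nonneg (hq0 v)).trans_le (hqL v)
  have hρi := intervalIntegrable_of_abs_le hρ hC
  have hΛc : Continuous fun v => ∫ x in a..v, q x :=
    intervalIntegral.continuous_primitive hqi a
  have hΛ0 : ∀ v ∈ Icc a t, 0 ≤ ∫ x in a..v, q x := fun v hv =>
    intervalIntegral.integral_nonneg hv.1 fun x _ => hq0 x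
  obtain ⟨M, hM⟩ := isCompact_Icc.exists_bound_of_continuousOn (s := Icc a t) hψ'.continuousOn
  have hpath : ∀ y, (∫ v in a..min (R y) t, ρ v) + (if R y ≤ t then ψ (R y) else φ t) =
      (∫ v in a..min (R y) t, ρ v + ψ' v) +
        (ψ a + (Ioi (∫ x in a..t, q x)).indicator (fun _ => φ t - ψ t) y) := fun y => by
    have hs : ∫ v in a..min (R y) t, ρ v + ψ' v =
        (∫ v in a..min (R y) t, ρ v) + (ψ (min (R y) t) - ψ a) := by
      rw [intervalIntegral.integral_add (hρi _ _) (hψ'.intervalIntegrable _ _),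
        intervalIntegral.integral_eq_sub_of_hasDerivAt (fun v _ => hψ v)
          (hψ'.intervalIntegrable _ _)]
    rw [hs]
    by_cases hy : R y ≤ t
    · have := (hR y t ⟨hat, le_rfl⟩).1 hy
      rw [if_pos hy, min_eq_left hy, indicator_of_notMem (by simpa using this)]
      ring
    · have := mt (hR y t ⟨hat, le_rfl⟩).2 hy
      rw [if_neg hy, min_eq_right (le_of_not_ge hy), indicator_of_mem (by simpa using this)]
      ring
  -- With the terminal reward in this form, only the law of `R` on `[a, t]` through
  -- `ℙ (v < R) = exp (-∫ q)` is needed, and no density of `R`.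
  simp_rw [hpath]
  have hbound : ∀ v ∈ Icc a t, |ρ v + ψ' v| ≤ C + M := fun v hv =>
    (abs_add_le _ _).trans (add_le_add (hC v) (hM v hv))
  have hρψ : Measurable fun v => ρ v + ψ' v := hρ.add hψ'.measurable
  have hint : Integrable (fun y => ∫ v in a..min (R y) t, ρ v + ψ' v) (expMeasure 1) := by
    have hc : Continuous fun z => ∫ v in a..z, ρ v + ψ' v :=
      intervalIntegral.continuous_primitive
        (fun x y => (hρi x y).add (hψ'.intervalIntegrable x y)) a
    refine Integrable.of_bound (C := (C + M) * (t - a))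
      (hc.measurable.comp (hRm.min measurable_const)).aestronglyMeasurable
      (Eventually.of_forall fun y => ?_)
    have hle := le_min (haR y) hat
    refine (intervalIntegral.norm_integral_le_of_norm_le_const (C := C + M)
      fun v hv => ?_).trans ?_
    · rw [uIoc_of_le hle] at hv
      exact hbound v ⟨hv.1.le, hv.2.trans (min_le_right _ _)⟩
    · rw [abs_of_nonneg (sub_nonneg.2 hle)]
      exact mul_le_mul_of_nonneg_left (sub_le_sub_right (min_le_right _ _) _)
        ((abs_nonneg _).trans (hbound a ⟨le_rfl, hat⟩))
  have hind : Integrable ((Ioi (∫ x in a..t, q x)).indicator fun _ => φ t - ψ t)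
      (expMeasure 1) := (integrable_const _).indicator measurableSet_Ioi
  rw [integral_add hint (by exact (integrable_const _).add hind),
    integral_integral_min_eq hat hΛ0 hRm haR hR hρψ hbound, integral_add (integrable_const _) hind,
    integral_indicator_const _ measurableSet_Ioi, expMeasure_one_real_Ioi (hΛ0 t ⟨hat, le_rfl⟩)]
  have hac := integral_exp_neg_mul_deriv hat hq hq0 hqL
    (D' := fun v => φ' v - ψ' v) (hφ'.sub hψ') (D := fun v => φ v - ψ v) (fun v => (hφ v).sub (hψ v))
  have hEc : Continuous fun v => Real.exp (-∫ x in a..v, q x) := Real.continuous_exp.comp hΛc.neg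
  have hφc : Continuous φ := continuous_iff_continuousAt.2 fun v => (hφ v).continuousAt
  have hψc : Continuous ψ := continuous_iff_continuousAt.2 fun v => (hψ v).continuousAt
  have hsplit : ∫ v in a..t, (ρ v + φ' v + q v * (ψ v - φ v)) * Real.exp (-∫ x in a..v, q x) =
      (∫ v in a..t, (ρ v + ψ' v) * Real.exp (-∫ x in a..v, q x)) +
        ∫ v in a..t, Real.exp (-∫ x in a..v, q x) * ((φ' v - ψ' v) - q v * (φ v - ψ v)) := by
    rw [← intervalIntegral.integral_add]
    · congr 1
      ext v
      ring
    · exact ((hρi _ _).add (hψ'.intervalIntegrable _ _)).mul_continuousOn hEc.continuousOn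
    · exact (((hφ'.sub hψ').intervalIntegrable _ _).sub
        ((hqi _ _).mul_continuousOn (hφc.sub hψc).continuousOn)).continuousOn_mul hEc.continuousOn
  rw [hsplit, hac]
  simp
  ring

/-! ### Measurability of the increment times -/

lemma measurable_parametric_intervalIntegral {α : Type*} [MeasurableSpace α] {g : α × ℝ → ℝ}
    (hg : Measurable g) {A B : α → ℝ} (hA : Measurable A) (hB : Measurable B) :
    Measurable fun x => ∫ v in (A x)..(B x), g (x, v) := by
  have key : ∀ {A B : α → ℝ}, Measurable A → Measurable B →
      Measurable fun x => ∫ v in Ioc (A x) (B x), g (x, v) := fun {A B} hA hB => by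
    have h1 : Measurable fun p : α × ℝ => (Ioc (A p.1) (B p.1)).indicator (fun v => g (p.1, v)) p.2 := by
      simp only [indicator, mem_Ioc]
      exact Measurable.ite ((measurableSet_lt (hA.comp measurable_fst) measurable_snd).inter
        (measurableSet_le measurable_snd (hB.comp measurable_fst))) hg measurable_const
    have h2 := (h1.stronglyMeasurable.integral_prod_right' (ν := volume)).measurable
    simpa only [integral_indicator measurableSet_Ioc] using h2
  exact (key hA hB).sub (key hB hA)

lemma measurable_lastTime (n : ℕ) : Measurable (ProductionSystem.lastTime n) := by
  cases n with
  | zero => exact measurable_const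
  | succ n => exact measurable_pi_apply _

namespace ProductionSystem

namespace Policy

variable {S : ProductionSystem} {x : ℕ}

/-- The deterioration intensity after the history `τ` of `n` increments. -/
def intensity (u : Policy S x) (n : ℕ) (τ : Fin n → ℝ) (v : ℝ) : ℝ := S.lam * S.f (u.rate n τ v)

lemma measurable_comp_rate (u : Policy S x) {g : ℝ → ℝ} (hS : S.IsStandard)
    (hg : ContinuousOn g (Icc 0 S.smax)) (n : ℕ) :
    Measurable fun p : (Fin n → ℝ) × ℝ => g (u.rate n p.1 p.2) := by
  have h := (continuousOn_iff_continuous_domRestrict.1 hg).Icc_extend' (h := hS.smax_pos.le)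
  have h2 := h.measurable.comp (u.measurable_rate n)
  convert h2 using 2 with p
  simp only [Function.comp_apply]
  rw [IccExtend_of_mem _ _ (u.rate_mem n p.1 p.2), domRestrict_apply]

lemma measurable_intensity (u : Policy S x) (hS : S.IsStandard) (n : ℕ) :
    Measurable fun p : (Fin n → ℝ) × ℝ => u.intensity n p.1 p.2 :=
  u.measurable_comp_rate hS (g := fun s => S.lam * S.f s) (continuousOn_const.mul hS.f_cont) n

lemma intensity_nonneg (u : Policy S x) (hS : S.IsStandard) (n : ℕ) (τ : Fin n → ℝ) (v : ℝ) :
    0 ≤ u.intensity n τ v := hS.lam_mul_f_nonneg (u.rate_mem n τ v)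

lemma intensity_le (u : Policy S x) (hS : S.IsStandard) (n : ℕ) (τ : Fin n → ℝ) (v : ℝ) :
    u.intensity n τ v ≤ S.lam * S.f S.smax := hS.lam_mul_f_le (u.rate_mem n τ v)

lemma intervalIntegrable_intensity (u : Policy S x) (hS : S.IsStandard) (n : ℕ) (τ : Fin n → ℝ)
    (y z : ℝ) : IntervalIntegrable (u.intensity n τ) volume y z :=
  intervalIntegrable_of_abs_le ((u.measurable_intensity hS n).comp measurable_prodMk_left)
    (fun v => (abs_of_nonneg (u.intensity_nonneg hS n τ v)).trans_le (u.intensity_le hS n τ v)) y z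

lemma abs_r_rate_le (u : Policy S x) (hS : S.IsStandard) (n : ℕ) (τ : Fin n → ℝ) (v : ℝ) :
    |S.r (u.rate n τ v)| ≤ max |S.r 0| |S.r S.smax| :=
  abs_le_max_abs_abs (hS.r_mono hS.zero_mem (u.rate_mem n τ v) (u.rate_mem n τ v).1)
    (hS.r_mono (u.rate_mem n τ v) hS.smax_mem (u.rate_mem n τ v).2)

lemma measurable_r_rate (u : Policy S x) (hS : S.IsStandard) (n : ℕ) (τ : Fin n → ℝ) :
    Measurable fun v => S.r (u.rate n τ v) :=
  (u.measurable_comp_rate hS hS.r_cont n).comp measurable_prodMk_left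

lemma intervalIntegrable_r_rate (u : Policy S x) (hS : S.IsStandard) (n : ℕ) (τ : Fin n → ℝ)
    (y z : ℝ) : IntervalIntegrable (fun v => S.r (u.rate n τ v)) volume y z :=
  intervalIntegrable_of_abs_le (u.measurable_r_rate hS n τ) (u.abs_r_rate_le hS n τ) y z

lemma bddBelow_nextJump_set (u : Policy S x) (t : ℝ) (n : ℕ) (τ : Fin n → ℝ) (a : ℝ) :
    BddBelow (insert (t + 1) {k : ℝ | lastTime n τ ≤ k ∧
      a ≤ ∫ v in (lastTime n τ)..k, S.lam * S.f (u.rate n τ v)}) :=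
  BddBelow.insert _ ⟨lastTime n τ, fun _ hk => hk.1⟩

lemma nextJump_le_add_one (u : Policy S x) (t : ℝ) (n : ℕ) (τ : Fin n → ℝ) (a : ℝ) :
    u.nextJump t n τ a ≤ t + 1 :=
  csInf_le (u.bddBelow_nextJump_set t n τ a) (mem_insert _ _)

lemma lastTime_le_nextJump (u : Policy S x) {t : ℝ} {n : ℕ} {τ : Fin n → ℝ}
    (h : lastTime n τ ≤ t + 1) (a : ℝ) : lastTime n τ ≤ u.nextJump t n τ a := by
  refine le_csInf ⟨_, mem_insert _ _⟩ ?_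
  rintro k (rfl | hk)
  · exact h
  · exact hk.1

/-- The next increment has occurred by time `z` if and only if the accumulated intensity has reached
the exponential level. -/
lemma nextJump_le_iff (u : Policy S x) (hS : S.IsStandard) {t : ℝ} (n : ℕ) (τ : Fin n → ℝ)
    (a : ℝ) {z : ℝ} (hz : z < t + 1) :
    u.nextJump t n τ a ≤ z ↔ lastTime n τ ≤ z ∧ a ≤ ∫ v in (lastTime n τ)..z, u.intensity n τ v := by
  have hb := u.bddBelow_nextJump_set t n τ a
  refine ⟨fun h => ?_, fun h => csInf_le hb (mem_insert_of_mem _ h)⟩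
  have hc : Continuous fun k => ∫ v in (lastTime n τ)..k, S.lam * S.f (u.rate n τ v) :=
    intervalIntegral.continuous_primitive (u.intervalIntegrable_intensity hS n τ) _
  have hcl : IsClosed (insert (t + 1) {k : ℝ | lastTime n τ ≤ k ∧
      a ≤ ∫ v in (lastTime n τ)..k, S.lam * S.f (u.rate n τ v)}) :=
    isClosed_singleton.union ((isClosed_le continuous_const continuous_id).inter
      (isClosed_le continuous_const hc))
  rcases hcl.csInf_mem ⟨_, mem_insert _ _⟩ hb with hmem | hmem
  · have : u.nextJump t n τ a = t + 1 := hmem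
    linarith
  · have h1 : lastTime n τ ≤ u.nextJump t n τ a := hmem.1
    have h2 : a ≤ ∫ v in (lastTime n τ)..(u.nextJump t n τ a), u.intensity n τ v := hmem.2
    refine ⟨h1.trans h, h2.trans ?_⟩
    exact intervalIntegral.integral_mono_interval le_rfl h1 h
      (Eventually.of_forall fun v => u.intensity_nonneg hS n τ v)
      (u.intervalIntegrable_intensity hS n τ _ _)

lemma measurable_nextJump (u : Policy S x) (hS : S.IsStandard) (t : ℝ) (n : ℕ) :
    Measurable fun p : (Fin n → ℝ) × ℝ => u.nextJump t n p.1 p.2 := by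
  refine measurable_of_Iic fun z => ?_
  by_cases hz : z < t + 1
  · have : (fun p : (Fin n → ℝ) × ℝ => u.nextJump t n p.1 p.2) ⁻¹' Iic z =
        {p | lastTime n p.1 ≤ z} ∩ {p | p.2 ≤ ∫ v in (lastTime n p.1)..z, u.intensity n p.1 v} := by
      ext p
      exact u.nextJump_le_iff hS n p.1 p.2 hz
    rw [this]
    have hl : Measurable fun p : (Fin n → ℝ) × ℝ => lastTime n p.1 :=
      (measurable_lastTime n).comp measurable_fst
    exact (measurableSet_le hl measurable_const).inter (measurableSet_le measurable_snd
      ((measurable_parametric_intervalIntegral (u.measurable_intensity hS n)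
        (measurable_lastTime n) measurable_const).comp measurable_fst))
  · convert MeasurableSet.univ
    exact eq_univ_of_forall fun p => (u.nextJump_le_add_one t n p.1 p.2).trans (not_lt.1 hz)

/-- The time of the `n`-th increment along a sample path (time `0` if `n = 0`). -/
def jumpTime (u : Policy S x) (t : ℝ) (e : ℕ → ℝ) (n : ℕ) : ℝ := lastTime n (u.jumpTimes t e n)

lemma jumpTime_zero (u : Policy S x) (t : ℝ) (e : ℕ → ℝ) : u.jumpTime t e 0 = 0 := rfl

lemma jumpTime_succ (u : Policy S x) (t : ℝ) (e : ℕ → ℝ) (n : ℕ) :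
    u.jumpTime t e (n + 1) = u.nextJump t n (u.jumpTimes t e n) (e n) := by
  simp [jumpTime, lastTime, jumpTimes]

lemma jumpTime_le (u : Policy S x) {t : ℝ} (ht : 0 ≤ t) (e : ℕ → ℝ) (n : ℕ) :
    u.jumpTime t e n ≤ t + 1 := by
  cases n with
  | zero => rw [jumpTime_zero]; linarith
  | succ n => rw [jumpTime_succ]; exact u.nextJump_le_add_one _ _ _ _

lemma monotone_jumpTime (u : Policy S x) {t : ℝ} (ht : 0 ≤ t) (e : ℕ → ℝ) :
    Monotone (u.jumpTime t e) :=
  monotone_nat_of_le_succ fun n => by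
    rw [jumpTime_succ]
    exact u.lastTime_le_nextJump (u.jumpTime_le ht e n) _

lemma jumpTime_nonneg (u : Policy S x) {t : ℝ} (ht : 0 ≤ t) (e : ℕ → ℝ) (n : ℕ) :
    0 ≤ u.jumpTime t e n := u.monotone_jumpTime ht e (Nat.zero_le n)

lemma jumpCount_eq (u : Policy S x) {t : ℝ} (ht : 0 ≤ t) (e : ℕ → ℝ) {n : ℕ} {k : ℝ}
    (h1 : u.jumpTime t e n ≤ k) (h2 : k < u.jumpTime t e (n + 1)) : u.jumpCount t e k = n := by
  have : {m : ℕ | u.jumpTimes t e (m + 1) (Fin.last m) ≤ k} = Iio n := by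
    ext m
    change u.jumpTime t e (m + 1) ≤ k ↔ m < n
    constructor
    · intro h
      by_contra! hmn
      exact (h2.trans_le (u.monotone_jumpTime ht e (Nat.succ_le_succ hmn))).not_ge h
    · exact fun h => (u.monotone_jumpTime ht e h).trans h1
  rw [jumpCount, this, ← Finset.coe_Iio, ncard_coe_finset, Nat.card_Iio]

lemma measurable_jumpTimes (u : Policy S x) (hS : S.IsStandard) (t : ℝ) (n : ℕ) :
    Measurable fun e : ℕ → ℝ => u.jumpTimes t e n := by
  induction n with
  | zero => exact measurable_pi_lambda _ fun i => i.elim0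
  | succ n ih =>
    refine measurable_pi_lambda _ fun i => ?_
    induction i using Fin.lastCases with
    | last =>
      have h : (fun e => u.jumpTimes t e (n + 1) (Fin.last n)) =
          fun e => u.nextJump t n (u.jumpTimes t e n) (e n) :=
        funext fun e => u.jumpTime_succ t e n
      rw [h]
      have hm : Measurable fun e : ℕ → ℝ => (u.jumpTimes t e n, e n) :=
        ih.prodMk (measurable_pi_apply n)
      have hc := (u.measurable_nextJump hS t n).comp hm
      exact hc
    | cast i =>
      have h : (fun e => u.jumpTimes t e (n + 1) i.castSucc) = fun e => u.jumpTimes t e n i :=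
        funext fun e => by simp only [jumpTimes, Fin.snoc_castSucc]
      rw [h]
      exact (measurable_pi_apply i).comp ih

lemma jumpTimes_congr (u : Policy S x) (t : ℝ) {e e' : ℕ → ℝ} (n : ℕ) (h : ∀ i < n, e i = e' i) :
    u.jumpTimes t e n = u.jumpTimes t e' n := by
  induction n with
  | zero => rfl
  | succ n ih =>
    rw [jumpTimes, jumpTimes, ih fun i hi => h i (by omega), h n (by omega)]

/-- The first `n` increment times are independent of the next exponential variable. -/
lemma map_jumpTimes_prod (u : Policy S x) (hS : S.IsStandard) (t : ℝ) (n : ℕ) :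
    (Measure.infinitePi fun _ : ℕ => expMeasure 1).map (fun e => (u.jumpTimes t e n, e n)) =
      ((Measure.infinitePi fun _ : ℕ => expMeasure 1).map (fun e => u.jumpTimes t e n)).prod
        (expMeasure 1) := by
  have hind := (iIndepFun_infinitePi (P := fun _ : ℕ => expMeasure 1)
    (X := fun _ y => y) fun _ => measurable_id).indepFun_finset (Finset.range n) {n}
      (by simp) (fun i => measurable_pi_apply i)
  -- `fill` extends the first `n` coordinates by zero.
  let fill : (Finset.range n → ℝ) → ℕ → ℝ := fun p i =>
    if hi : i ∈ Finset.range n then p ⟨i, hi⟩ else 0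
  have hfill : Measurable fill := measurable_pi_lambda _ fun i => by
    by_cases hi : i ∈ Finset.range n
    · simp only [fill, hi, dif_pos]; exact measurable_pi_apply _
    · simp only [fill, hi, dif_neg, not_false_eq_true]; exact measurable_const
  have heval : Measurable fun p : ({n} : Finset ℕ) → ℝ => p ⟨n, Finset.mem_singleton_self n⟩ :=
    measurable_pi_apply (X := fun _ : ({n} : Finset ℕ) => ℝ) ⟨n, Finset.mem_singleton_self n⟩
  have hind' := hind.comp (φ := fun p => u.jumpTimes t (fill p) n)
    (ψ := fun p : ({n} : Finset ℕ) → ℝ => p ⟨n, Finset.mem_singleton_self n⟩)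
    ((u.measurable_jumpTimes hS t n).comp hfill) heval
  have heq : (fun p => u.jumpTimes t (fill p) n) ∘
      (fun (e : ℕ → ℝ) (i : Finset.range n) => e i) = fun e => u.jumpTimes t e n := by
    ext1 e
    refine u.jumpTimes_congr t n fun i hi => ?_
    simp [fill, hi]
  rw [heq] at hind'
  have h := (indepFun_iff_map_prod_eq_prod_map_map (u.measurable_jumpTimes hS t n).aemeasurable
    (measurable_pi_apply n).aemeasurable).1 hind'
  rw [Measure.infinitePi_map_eval] at h
  exact h

end Policy

end ProductionSystem

lemma ae_forall_exponential_pos :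
    ∀ᵐ e ∂(Measure.infinitePi fun _ : ℕ => expMeasure 1), ∀ i, 0 < e i := by
  refine ae_all_iff.2 fun i => ?_
  exact (measurePreserving_eval_infinitePi (fun _ : ℕ => expMeasure 1)
    i).quasiMeasurePreserving.ae expMeasure_one_ae_pos

namespace ProductionSystem

namespace Policy

variable {S : ProductionSystem}

/-! ### Decomposition of the profit along a sample path -/

/-- The amount by which the value process changes between the increments `n` and `n + 1`: the
revenue earned in between, plus the value at the later of the two, minus the value at the earlier.
Here `τ` are the times of the first `n` increments and `y` is the exponential level that drives the
next one. The change is zero if the increment `n` is not in `[0, t]`. -/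
def gain (u : Policy S 0) (V : ℕ → ℝ → ℝ) (t : ℝ) (n : ℕ) (τ : Fin n → ℝ) (y : ℝ) : ℝ :=
  (Icc 0 t).indicator (fun _ =>
    ((∫ v in (lastTime n τ)..min (u.nextJump t n τ y) t, S.r (u.rate n τ v)) +
      if u.nextJump t n τ y ≤ t then V (n + 1) (t - u.nextJump t n τ y) else V n 0) -
      V n (t - lastTime n τ)) (lastTime n τ)

variable {T t : ℝ} {V h : ℕ → ℝ → ℝ}

lemma measurable_gain (u : Policy S 0) (hS : S.IsStandard) (hV : S.IsValue T V h) (t : ℝ) (n : ℕ) :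
    Measurable fun p : (Fin n → ℝ) × ℝ => u.gain V t n p.1 p.2 := by
  have hl : Measurable fun p : (Fin n → ℝ) × ℝ => lastTime n p.1 :=
    (measurable_lastTime n).comp measurable_fst
  have hR := u.measurable_nextJump hS t n
  have hr : Measurable fun p : ((Fin n → ℝ) × ℝ) × ℝ => S.r (u.rate n p.1.1 p.2) := by
    have hm : Measurable fun p : ((Fin n → ℝ) × ℝ) × ℝ => (p.1.1, p.2) :=
      (measurable_fst.comp measurable_fst).prodMk measurable_snd
    have hc := (u.measurable_comp_rate hS hS.r_cont n).comp hm
    exact hc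
  have hint := measurable_parametric_intervalIntegral hr hl (hR.min (measurable_const (a := t)))
  simp only [gain, indicator]
  refine Measurable.ite (hl measurableSet_Icc) ?_ measurable_const
  refine (hint.add (Measurable.ite (measurableSet_le hR measurable_const) ?_
    measurable_const)).sub ?_
  · exact (hV.continuous (n + 1)).measurable.comp (measurable_const.sub hR)
  · exact (hV.continuous n).measurable.comp (measurable_const.sub hl)

lemma exists_abs_gain_le (u : Policy S 0) (hS : S.IsStandard) (hV : S.IsValue T V h) (ht : 0 ≤ t)
    (n : ℕ) : ∃ C, ∀ τ y, |u.gain V t n τ y| ≤ C := by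
  obtain ⟨M, hM⟩ := isCompact_Icc.exists_bound_of_continuousOn (s := Icc 0 t)
    (hV.continuous n).continuousOn
  obtain ⟨M', hM'⟩ := isCompact_Icc.exists_bound_of_continuousOn (s := Icc 0 t)
    (hV.continuous (n + 1)).continuousOn
  set B := max |S.r 0| |S.r S.smax|
  have hB : 0 ≤ B := le_max_of_le_left (abs_nonneg _)
  have h0 : (0 : ℝ) ∈ Icc 0 t := ⟨le_rfl, ht⟩
  have hM0 : 0 ≤ M := (norm_nonneg _).trans (hM 0 h0)
  have hM0' : 0 ≤ M' := (norm_nonneg _).trans (hM' 0 h0)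
  refine ⟨B * t + (M + M') + M, fun τ y => ?_⟩
  by_cases hmem : lastTime n τ ∈ Icc 0 t
  · rw [gain, indicator_of_mem hmem]
    have hle := u.lastTime_le_nextJump (by linarith [hmem.2] : lastTime n τ ≤ t + 1) y
    refine (abs_sub _ _).trans (add_le_add ((abs_add_le _ _).trans (add_le_add ?_ ?_)) ?_)
    · refine (intervalIntegral.norm_integral_le_of_norm_le_const
        (f := fun v => S.r (u.rate n τ v)) fun v _ => u.abs_r_rate_le hS n τ v).trans ?_
      rw [abs_of_nonneg (sub_nonneg.2 (le_min hle hmem.2))]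
      refine mul_le_mul_of_nonneg_left ?_ hB
      linarith [min_le_right (u.nextJump t n τ y) t, hmem.1]
    · split_ifs with hR
      · have := hM' (t - u.nextJump t n τ y) ⟨by linarith, by linarith [hmem.1]⟩
        rw [Real.norm_eq_abs] at this
        linarith
      · have := hM 0 h0
        rw [Real.norm_eq_abs] at this
        linarith
    · exact hM _ ⟨by linarith [hmem.2], by linarith [hmem.1]⟩
  · rw [gain, indicator_of_notMem hmem, abs_zero]
    positivity

/-- Once the failure level is reached, there are no more increments. -/
lemma lt_jumpTime_failed (u : Policy S 0) (hS : S.IsStandard) {e : ℕ → ℝ}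
    (he : 0 < e S.ξ) : t < u.jumpTime t e (S.ξ + 1) := by
  rw [jumpTime_succ]
  by_contra! hle
  have h := ((u.nextJump_le_iff hS _ _ _ (by linarith)).1 hle).2
  have h0 : ∀ v, u.intensity S.ξ (u.jumpTimes t e S.ξ) v = 0 := fun v => by
    rw [intensity, u.rate_failed _ _ _ (by omega), hS.f_zero, mul_zero]
  simp only [h0, intervalIntegral.integral_zero] at h
  linarith

/-- The revenue up to the horizon is the sum of the revenues between consecutive increments. -/
lemma integral_revenue_eq_sum (u : Policy S 0) (hS : S.IsStandard) (ht : 0 ≤ t) {e : ℕ → ℝ}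
    (he : 0 < e S.ξ) :
    ∫ k in (0 : ℝ)..t, S.r (u.production t e k) = ∑ i ∈ Finset.range (S.ξ + 1),
      ∫ v in min (u.jumpTime t e i) t..min (u.jumpTime t e (i + 1)) t,
        S.r (u.rate i (u.jumpTimes t e i) v) := by
  have hcongr : ∀ i, ∀ v ∈ Ioo (min (u.jumpTime t e i) t) (min (u.jumpTime t e (i + 1)) t),
      S.r (u.rate i (u.jumpTimes t e i) v) = S.r (u.production t e v) := fun i v hv => by
    have h1 := lt_min_iff.1 hv.2
    have h2 : u.jumpTime t e i ≤ v := (min_lt_iff.1 hv.1).elim le_of_lt fun h => by linarith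
    rw [production, u.jumpCount_eq ht e h2 h1.1]
  have hle : ∀ i, min (u.jumpTime t e i) t ≤ min (u.jumpTime t e (i + 1)) t := fun i =>
    min_le_min_right t (u.monotone_jumpTime ht e i.le_succ)
  have hsum := intervalIntegral.sum_integral_adjacent_intervals (μ := volume)
    (f := fun k => S.r (u.production t e k))
    (a := fun i => min (u.jumpTime t e i) t) (n := S.ξ + 1) fun i _ => by
      refine (u.intervalIntegrable_r_rate hS i (u.jumpTimes t e i) _ _).congr_uIoo ?_
      rw [uIoo_of_le (hle i)]
      exact hcongr i
  rw [u.jumpTime_zero, min_eq_left ht, min_eq_right (u.lt_jumpTime_failed hS he).le] at hsum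
  rw [← hsum]
  refine Finset.sum_congr rfl fun i _ => ?_
  rw [intervalIntegral.integral_of_le (hle i), intervalIntegral.integral_of_le (hle i),
    integral_Ioc_eq_integral_Ioo, integral_Ioc_eq_integral_Ioo]
  exact (setIntegral_congr_fun measurableSet_Ioo (hcongr i)).symm

/-- The value process just after the increment `n`: the sum of the gains telescopes. -/
lemma sum_gain_eq (u : Policy S 0) (hV : S.IsValue T V h) (ht : 0 ≤ t) (e : ℕ → ℝ)
    {n : ℕ} (hn : n ≤ S.ξ) :
    V 0 t + ∑ i ∈ Finset.range n, u.gain V t i (u.jumpTimes t e i) (e i) =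
      (∑ i ∈ Finset.range n, ∫ v in min (u.jumpTime t e i) t..min (u.jumpTime t e (i + 1)) t,
        S.r (u.rate i (u.jumpTimes t e i) v)) +
      if u.jumpTime t e n ≤ t then V n (t - u.jumpTime t e n) else -S.c (u.jumpCount t e t) := by
  induction n with
  | zero => simp [u.jumpTime_zero, ht]
  | succ n ih =>
    rw [Finset.sum_range_succ, ← add_assoc, ih (by omega), Finset.sum_range_succ]
    by_cases h1 : u.jumpTime t e n ≤ t
    · have hmem : lastTime n (u.jumpTimes t e n) ∈ Icc 0 t := ⟨u.jumpTime_nonneg ht e n, h1⟩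
      rw [gain, indicator_of_mem hmem, ← u.jumpTime_succ]
      rw [if_pos h1, min_eq_left h1]
      change _ + _ + ((∫ v in (u.jumpTime t e n).._, _) + _ - V n (t - u.jumpTime t e n)) = _
      by_cases h2 : u.jumpTime t e (n + 1) ≤ t
      · rw [if_pos h2, if_pos h2]
        ring
      · rw [if_neg h2, if_neg h2, u.jumpCount_eq ht e h1 (not_le.1 h2), hV.zero n (by omega)]
        ring
    · have h2 : ¬ u.jumpTime t e (n + 1) ≤ t := fun h =>
        h1 ((u.monotone_jumpTime ht e n.le_succ).trans h)
      rw [gain, indicator_of_notMem fun hmem => h1 hmem.2, if_neg h1, if_neg h2,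
        min_eq_right (le_of_not_ge h1), min_eq_right (le_of_not_ge h2),
        intervalIntegral.integral_same, add_zero, add_zero]

lemma pathProfit_eq (u : Policy S 0) (hS : S.IsStandard) (hV : S.IsValue T V h) (ht : 0 ≤ t)
    {e : ℕ → ℝ} (he : 0 < e S.ξ) :
    u.pathProfit t e =
      V 0 t + ∑ i ∈ Finset.range S.ξ, u.gain V t i (u.jumpTimes t e i) (e i) := by
  rw [u.sum_gain_eq hV ht e le_rfl, pathProfit, u.integral_revenue_eq_sum hS ht he,
    Finset.sum_range_succ, level, zero_add]
  have hlt := u.lt_jumpTime_failed hS he (t := t)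
  have hr : ∀ v, S.r (u.rate S.ξ (u.jumpTimes t e S.ξ) v) = S.r 0 := fun v => by
    rw [u.rate_failed _ _ _ (by omega)]
  simp only [hr]
  rw [min_eq_right hlt.le]
  by_cases h1 : u.jumpTime t e S.ξ ≤ t
  · rw [if_pos h1, min_eq_left h1, u.jumpCount_eq ht e h1 hlt, hV.failed,
      intervalIntegral.integral_const, smul_eq_mul]
    ring
  · rw [if_neg h1, min_eq_right (le_of_not_ge h1), intervalIntegral.integral_same]
    ring

/-! ### Verification -/

/-- The expected profit differs from the value by the expected gains. By independence, each
of them is an average over the history of the expectation over the next exponential variable. -/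
lemma expectedProfit_eq (u : Policy S 0) (hS : S.IsStandard) (hV : S.IsValue T V h) (ht : 0 ≤ t) :
    u.expectedProfit t = V 0 t + ∑ n ∈ Finset.range S.ξ,
      ∫ τ, (∫ y, u.gain V t n τ y ∂(expMeasure 1))
        ∂((Measure.infinitePi fun _ : ℕ => expMeasure 1).map fun e => u.jumpTimes t e n) := by
  have hm : ∀ n, Measurable fun e : ℕ → ℝ => (u.jumpTimes t e n, e n) := fun n =>
    (u.measurable_jumpTimes hS t n).prodMk (measurable_pi_apply n)
  have hprob : ∀ n, IsProbabilityMeasure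
      ((Measure.infinitePi fun _ : ℕ => expMeasure 1).map fun e => u.jumpTimes t e n) := fun n =>
    Measure.isProbabilityMeasure_map (u.measurable_jumpTimes hS t n).aemeasurable
  have hint : ∀ (n : ℕ) (μ : Measure ((Fin n → ℝ) × ℝ)) [IsFiniteMeasure μ],
      Integrable (fun p => u.gain V t n p.1 p.2) μ := fun n μ _ => by
    obtain ⟨C, hC⟩ := u.exists_abs_gain_le hS hV ht n
    exact Integrable.of_bound (u.measurable_gain hS hV t n).aestronglyMeasurable C
      (Eventually.of_forall fun p => hC p.1 p.2)
  have hint' : ∀ n, Integrable (fun e => u.gain V t n (u.jumpTimes t e n) (e n))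
      (Measure.infinitePi fun _ : ℕ => expMeasure 1) := fun n => by
    have := (hint n ((Measure.infinitePi fun _ : ℕ => expMeasure 1).map
      (fun e => (u.jumpTimes t e n, e n)))).comp_measurable (hm n)
    exact this
  rw [expectedProfit, integral_congr_ae (ae_forall_exponential_pos.mono fun e he =>
    u.pathProfit_eq hS hV ht (he S.ξ)), integral_add (integrable_const _)
      (integrable_finsetSum _ fun n _ => hint' n), integral_finsetSum _ fun n _ => hint' n]
  simp only [integral_const, probReal_univ, one_smul]
  congr 1
  refine Finset.sum_congr rfl fun n _ => ?_
  rw [← integral_prod (fun p : (Fin n → ℝ) × ℝ => u.gain V t n p.1 p.2) (hint n _),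
    ← u.map_jumpTimes_prod hS t n, integral_map (hm n).aemeasurable
      (u.measurable_gain hS hV t n).aestronglyMeasurable]

/-- The expected gain, given the history, weighs the defect of the policy in the
Hamilton–Jacobi–Bellman equation by the probability that no increment has occurred yet. -/
lemma integral_gain_eq (u : Policy S 0) (hS : S.IsStandard) (hV : S.IsValue T V h)
    (ht : t ∈ Icc 0 T) {n : ℕ} (hn : n < S.ξ) {τ : Fin n → ℝ} (hτ : lastTime n τ ∈ Icc 0 t) :
    ∫ y, u.gain V t n τ y ∂(expMeasure 1) = ∫ v in (lastTime n τ)..t,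
      (S.netRate (u.rate n τ v) (V n (t - v) - V (n + 1) (t - v)) -
        S.hamiltonian (V n (t - v) - V (n + 1) (t - v))) *
      Real.exp (-∫ w in (lastTime n τ)..v, u.intensity n τ w) := by
  have hval : ∀ n v, HasDerivAt (fun v => V n (t - v)) (-h n (t - v)) v := fun n v => by
    simpa using (hV.hasDerivAt n (t - v)).comp_const_sub t v
  have hcont : ∀ n, Continuous fun v => -h n (t - v) := fun n =>
    ((hV.continuous_deriv n).comp (continuous_const.sub continuous_id)).neg
  have hR : Measurable fun y => u.nextJump t n τ y :=
    (u.measurable_nextJump hS t n).comp measurable_prodMk_left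
  have hformula := integral_reward_until_ring (a := lastTime n τ) (t := t) hτ.2
    ((u.measurable_intensity hS n).comp measurable_prodMk_left) (u.intensity_nonneg hS n τ)
    (u.intensity_le hS n τ) (u.measurable_r_rate hS n τ) (u.abs_r_rate_le hS n τ) hR
    (u.lastTime_le_nextJump (by linarith [hτ.2]))
    (fun y z hz => by
      rw [u.nextJump_le_iff hS n τ y (by linarith [hz.2] : z < t + 1)]
      exact and_iff_right hz.1)
    (hcont n) (hval n) (hcont (n + 1)) (hval (n + 1))
  have hgain : ∀ y, (∫ v in (lastTime n τ)..min (u.nextJump t n τ y) t, S.r (u.rate n τ v)) +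
      (if u.nextJump t n τ y ≤ t then V (n + 1) (t - u.nextJump t n τ y) else V n (t - t)) =
      u.gain V t n τ y + V n (t - lastTime n τ) := fun y => by
    rw [gain, indicator_of_mem hτ, sub_self, sub_add_cancel]
  obtain ⟨C, hC⟩ := u.exists_abs_gain_le hS hV ht.1 n
  have hint : Integrable (fun y => u.gain V t n τ y) (expMeasure 1) :=
    Integrable.of_bound ((u.measurable_gain hS hV t n).comp
      measurable_prodMk_left).aestronglyMeasurable C (Eventually.of_forall fun y => hC τ y)
  simp only [hgain] at hformula
  rw [integral_add hint (integrable_const _), integral_const, probReal_univ, one_smul,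
    add_comm (V n _)] at hformula
  rw [add_right_cancel hformula]
  refine intervalIntegral.integral_congr fun v hv => ?_
  rw [uIcc_of_le hτ.2] at hv
  simp only [Function.comp_apply]
  rw [hV.deriv_eq_hamiltonian hS hn (w := t - v)
    ⟨by linarith [hv.2], by linarith [hv.1, hτ.1, ht.2]⟩]
  simp only [netRate, intensity]
  ring

lemma expectedProfit_le (u : Policy S 0) (hS : S.IsStandard) (hV : S.IsValue T V h)
    (ht : t ∈ Icc 0 T) : u.expectedProfit t ≤ V 0 t := by
  rw [u.expectedProfit_eq hS hV ht.1]
  refine add_le_of_nonpos_right (Finset.sum_nonpos fun n hn => integral_nonpos fun τ => ?_)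
  by_cases hτ : lastTime n τ ∈ Icc 0 t
  · rw [u.integral_gain_eq hS hV ht (Finset.mem_range.1 hn) hτ, Pi.zero_apply, ← neg_nonneg,
      ← intervalIntegral.integral_neg]
    refine intervalIntegral.integral_nonneg hτ.2 fun v _ => neg_nonneg.2 ?_
    exact mul_nonpos_of_nonpos_of_nonneg
      (sub_nonpos.2 (hS.netRate_le_hamiltonian (u.rate_mem n τ v) _)) (Real.exp_pos _).le
  · simp only [gain, indicator_of_notMem hτ, integral_zero, Pi.zero_apply, le_refl]

/-- The feedback policy that maximizes the net profit rate at each level and time, for values `V`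
of the levels and the horizon `t`. -/
def feedback (hS : S.IsStandard) (hV : S.IsValue T V h) (t : ℝ) : Policy S 0 where
  rate n _ k := if n < S.ξ then S.optRate (V n (t - k) - V (n + 1) (t - k)) else 0
  measurable_rate n := by
    split_ifs
    · have hc : Continuous fun p : (Fin n → ℝ) × ℝ => V n (t - p.2) - V (n + 1) (t - p.2) := by
        have h1 := hV.continuous n
        have h2 := hV.continuous (n + 1)
        fun_prop
      exact hS.antitone_optRate.measurable.comp hc.measurable
    · exact measurable_const
  rate_mem n τ k := by
    split_ifs
    · exact hS.optRate_mem _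
    · exact hS.zero_mem
  rate_failed n τ k hn := if_neg (by omega)

lemma expectedProfit_feedback (hS : S.IsStandard) (hV : S.IsValue T V h) (ht : t ∈ Icc 0 T) :
    (feedback hS hV t).expectedProfit t = V 0 t := by
  rw [expectedProfit_eq _ hS hV ht.1, Finset.sum_eq_zero, add_zero]
  intro n hn
  rw [integral_eq_zero_of_ae (Eventually.of_forall fun τ => ?_)]
  by_cases hτ : lastTime n τ ∈ Icc 0 t
  · rw [integral_gain_eq _ hS hV ht (Finset.mem_range.1 hn) hτ]
    simp [feedback, hamiltonian, Finset.mem_range.1 hn]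
  · simp only [gain, indicator_of_notMem hτ, integral_zero, Pi.zero_apply]

end Policy

variable {S : ProductionSystem} {T t : ℝ} {V h : ℕ → ℝ → ℝ}

lemma optimalProfit_eq (hS : S.IsStandard) (hV : S.IsValue T V h) (ht : t ∈ Icc 0 T) :
    S.optimalProfit 0 t = V 0 t := by
  have hle : ∀ u : Policy S 0, u.expectedProfit t ≤ V 0 t := fun u => u.expectedProfit_le hS hV ht
  have : Nonempty (Policy S 0) := ⟨Policy.feedback hS hV t⟩
  refine le_antisymm (ciSup_le hle) ?_
  rw [← Policy.expectedProfit_feedback hS hV ht]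
  exact le_ciSup (f := fun u : Policy S 0 => u.expectedProfit t)
    ⟨V 0 t, forall_mem_range.2 hle⟩ _

lemma concaveOn_optimalProfit (hS : S.IsStandard) : ConcaveOn ℝ (Ioi 0) (S.optimalProfit 0) := by
  refine ⟨convex_Ioi 0, fun x hx y hy a b ha hb hab => ?_⟩
  have hT : (0 : ℝ) ≤ max x y := le_max_of_le_left (le_of_lt hx)
  obtain ⟨V, h, hV⟩ := hS.exists_isValue hT
  have hx' : x ∈ Icc 0 (max x y) := ⟨le_of_lt hx, le_max_left x y⟩
  have hy' : y ∈ Icc 0 (max x y) := ⟨le_of_lt hy, le_max_right x y⟩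
  rw [optimalProfit_eq hS hV hx', optimalProfit_eq hS hV hy',
    optimalProfit_eq hS hV (convex_Icc 0 _ hx' hy' ha hb hab)]
  exact (hV.concaveOn hS (Nat.zero_le _)).2 hx' hy' ha hb hab

end ProductionSystem

/-! ### Averages of concave functions -/

/-- The superlevel sets of the average `J T / T` of a concave function are convex; even more, the
average is larger than `m` strictly between two points where it is `≥ m` and `> m`. -/
lemma ConcaveOn.lt_div_of_mem_openSegment {J : ℝ → ℝ} (hJ : ConcaveOn ℝ (Ioi 0) J) {x y z m : ℝ}
    (hx : 0 < x) (hy : 0 < y) (hz : z ∈ openSegment ℝ x y) (hmx : m ≤ J x / x) (hmy : m < J y / y) :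
    m < J z / z := by
  obtain ⟨a, b, ha, hb, hab, rfl⟩ := hz
  have h := hJ.2 hx hy ha.le hb.le hab
  simp only [smul_eq_mul] at h ⊢
  rw [le_div_iff₀ hx] at hmx
  rw [lt_div_iff₀ hy] at hmy
  rw [lt_div_iff₀ (by positivity)]
  nlinarith [mul_le_mul_of_nonneg_left hmx ha.le, mul_lt_mul_of_pos_left hmy hb]

lemma ConcaveOn.div_lt_of_isLocalMax {J : ℝ → ℝ} (hJ : ConcaveOn ℝ (Ioi 0) J) {T' : ℝ}
    (hT' : 0 < T') (hloc : ∀ᶠ T in 𝓝[≠] T', J T / T < J T' / T') {T : ℝ} (hT : 0 < T)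
    (hne : T ≠ T') : J T / T < J T' / T' := by
  by_contra! hge
  -- Points of the open segment near `T'` would have an average of at least `J T' / T'`.
  have hseg : ∀ a ∈ Ioo (0 : ℝ) 1, J T' / T' ≤ J (T' + a * (T - T')) / (T' + a * (T - T')) := by
    intro a ha
    have h := hJ.2 hT' hT (sub_nonneg.2 ha.2.le) ha.1.le (sub_add_cancel 1 a)
    have hpos : 0 < T' + a * (T - T') := by nlinarith [ha.1, ha.2, mul_pos ha.1 hT]
    have hz : (1 - a) • T' + a • T = T' + a * (T - T') := by simp only [smul_eq_mul]; ring
    rw [hz, smul_eq_mul, smul_eq_mul] at h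
    rw [le_div_iff₀ hT] at hge
    rw [le_div_iff₀ hpos]
    have h2 : (1 - a) * (J T' / T' * T') = (1 - a) * J T' := by rw [div_mul_cancel₀ _ hT'.ne']
    have h3 := mul_le_mul_of_nonneg_left hge ha.1.le
    generalize J T' / T' = m at *
    linarith
  have htend : Tendsto (fun a : ℝ => T' + a * (T - T')) (𝓝[>] 0) (𝓝[≠] T') := by
    refine tendsto_nhdsWithin_iff.2 ⟨?_, ?_⟩
    · have hc : Continuous fun a : ℝ => T' + a * (T - T') := by fun_prop
      have := hc.tendsto 0
      simp only [zero_mul, add_zero] at this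
      exact this.mono_left nhdsWithin_le_nhds
    · filter_upwards [self_mem_nhdsWithin] with a ha
      simpa [sub_eq_zero, hne] using ne_of_gt ha
  obtain ⟨a, hlt, ha⟩ := ((htend.eventually hloc).and (Ioo_mem_nhdsGT one_pos)).exists
  exact (hseg a ha).not_gt hlt

end

theorem theorem2 (S : ProductionSystem) (hS : S.IsStandard) (T' : ℝ) (hT' : 0 < T')
    (hloc : ∀ᶠ T in 𝓝[≠] T', S.averageProfit T < S.averageProfit T') :
    (∀ T : ℝ, 0 < T → T ≠ T' → S.averageProfit T < S.averageProfit T') ∧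
      StrictMonoOn S.averageProfit (Ioc 0 T') ∧ StrictAntiOn S.averageProfit (Ici T') := by
  have hJ := ProductionSystem.concaveOn_optimalProfit hS
  have hmax : ∀ T : ℝ, 0 < T → T ≠ T' → S.averageProfit T < S.averageProfit T' :=
    fun T hT hne => hJ.div_lt_of_isLocalMax hT' hloc hT hne
  refine ⟨hmax, fun x hx y hy hxy => ?_, fun x hx y hy hxy => ?_⟩
  · rcases hy.2.lt_or_eq with hlt | rfl
    · by_contra! hle
      have hz : y ∈ openSegment ℝ x T' := by
        rw [openSegment_eq_Ioo (hxy.trans hlt)]; exact ⟨hxy, hlt⟩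
      exact lt_irrefl _ (hJ.lt_div_of_mem_openSegment hx.1 hT' hz hle (hmax y hy.1 hlt.ne))
    · exact hmax x hx.1 hxy.ne
  · have hx0 : 0 < x := hT'.trans_le hx
    have hy0 : 0 < y := hx0.trans hxy
    rcases (mem_Ici.1 hx).lt_or_eq with hlt | rfl
    · by_contra! hle
      have hz : x ∈ openSegment ℝ y T' := by
        rw [openSegment_symm, openSegment_eq_Ioo (hlt.trans hxy)]; exact ⟨hlt, hxy⟩
      exact lt_irrefl _ (hJ.lt_div_of_mem_openSegment hy0 hT' hz hle (hmax x hx0 hlt.ne'))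
    · exact hmax y hy0 hxy.ne'
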